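/- **Theorem.** Let $\mathcal C$ be a category, $(T,\mu,\eta)$ a monad on $\mathcal C$ and $F$ an endofunctor of $\mathcal C$. Let $\alpha$ be an ordinal with its Alexandrov topology: the opens are the ordinals $\beta\le\alpha$, and a family of $\beta_i\le\beta$ covers $\beta$ iff $\beta=\bigcup_i\beta_i$. Let $\mathrm{Sh}_\alpha(\mathcal C)$ be the category of $\mathcal C$-valued sheaves for this topology, and assume that the inclusion $\mathbf i$ of sheaves into $\mathcal C$-valued presheaves has a left adjoint $\mathbf a$ with unit $u$; thus the constant sheaf adjunction $\Delta\dashv\Gamma$ is defined, where $\Delta$ sheafifies constant presheaves and $\Gamma(X)=X_\alpha$. Notation. * The pointwise extension of an endofunctor $G$ of $\mathcal C$ is $\overline G=\mathbf a\circ(G\circ-)\circ\mathbf i$, an endofunctor of $\mathrm{Sh}_\alpha(\mathcal C)$. The functor $\overline T$ carries the monad structure with unit $X\cong\mathbf a\mathbf i X\xrightarrow{\mathbf a\eta}\overline TX$ and multiplication $\overline T\,\overline TX\cong\overline{TT}X\xrightarrow{\mathbf a\mu}\overline TX$, where the isomorphisms are induced by $\mathbf a\dashv\mathbf i$. * The later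 functor is $\blacktriangleright=\mathbf a\circ p^*\circ\mathbf i$, where $p(\beta)=\sup\{\gamma\mid\gamma<\beta\}$ and $p^*X=X\circ p$. * A final sequence of $F$ is a functor $\Phi\colon\mathrm{Ord}^{op}\to\mathcal C$ with $\Phi_{\beta+1}=F\Phi_\beta$ and $(\Phi_{\beta'+1}\to\Phi_{\beta+1})=F(\Phi_{\beta'}\to\Phi_\beta)$ for all $\beta\le\beta'$, and with $\Phi_\gamma=\lim_{\beta<\gamma}\Phi_\beta$ (via the maps $\Phi_\gamma\to\Phi_\beta$) whenever $\gamma$ is $0$ or a limit ordinal. It is stable at $\alpha$ if $\Phi_{\alpha+1}\to\Phi_\alpha$ is an isomorphism. Its restriction to the ordinals $\beta\le\alpha$ is a sheaf, denoted $\Phi(F)$. * $K\colon\mathrm{Sh}_\alpha(\mathcal C)\to\mathrm{Kl}(\overline T)$ is the canonical functor to the Kleisli category. A Kleisli lifting of an endofunctor $G$ of $\mathrm{Sh}_\alpha(\mathcal C)$ is an endofunctor $H$ of $\mathrm{Kl}(\overline T)$ with $H\circ K=K\circ G$. * An invariant of an endofunctor $H$ is an object $X$ with an isomorphism $X\cong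 HX$. Assume that a final sequence of $F$ exists and is stable at $\alpha$, and let $H$ be any Kleisli lifting of $\overline F\blacktriangleright$ to $\mathrm{Kl}(\overline T)$. Then: 1. There is exactly one isomorphism $c\colon\Phi(F)\to\overline F\blacktriangleright\Phi(F)$ in $\mathrm{Sh}_\alpha(\mathcal C)$ that is the identity of $\Phi(F)$, in the sense that at every stage $\beta+1\le\alpha$ its component is the canonical identification $\Phi_{\beta+1}=F\Phi_\beta=F\Phi_{p(\beta+1)}\cong F\big((\blacktriangleright\Phi(F))_{\beta+1}\big)\cong\big(\overline F\blacktriangleright\Phi(F)\big)_{\beta+1}$ given by components of $u$. 2. Up to unique isomorphism, the only invariant of $H$ is $K(c)\colon K\Phi(F)\to K\overline F\blacktriangleright\Phi(F)=HK\Phi(F)$, the image of the identity on $\Phi(F)$: for every invariant $k\colon Y\cong HY$ there is exactly one isomorphism $i\colon Y\to K\Phi(F)$ with $H(i)\circ k=K(c)\circ i$. Moreover $K(c)$ is a final $H$-coalgebra and $K(c)^{-1}$ is an initial $H$-algebra. -/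

import Mathlib

open CategoryTheory CategoryTheory.Limits Opposite

universe w v u

noncomputable section

namespace KleisliTrace

/-! ### Sheaves on the Alexandrov topology of an ordinal -/

/-- The open sets of an ordinal `α = {γ | γ < α}` for the Alexandrov topology are its downward
closed subsets, that is, the ordinals `β = {γ | γ < β}` with `β ≤ α`. They form a poset. -/
abbrev Stage (α : Ordinal.{w}) : Type (w + 1) := Set.Iic α

/-- The coverage by open covers: a sieve on the open `β = {γ | γ < β}` is covering iff
every point `γ < β` lies in some member `δ = {γ | γ < δ}` of the sieve. -/
def alexandrov (α : Ordinal.{w}) : GrothendieckTopology (Stage α) where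
  sieves β := {S | ∀ γ : Ordinal.{w}, γ < β.1 → ∃ (δ : Stage α) (f : δ ⟶ β), S f ∧ γ < δ.1}
  top_mem' β γ hγ := ⟨β, 𝟙 β, trivial, hγ⟩
  pullback_stable' {β β'} S f hS γ hγ := by
    obtain ⟨δ, g, hg, hδ⟩ := hS γ (lt_of_lt_of_le hγ (leOfHom f))
    refine ⟨δ ⊓ β', homOfLE inf_le_right, ?_, ?_⟩
    · change S _
      have := S.downward_closed hg (homOfLE (inf_le_left : δ ⊓ β' ≤ δ))
      exact this
    · rcases le_total δ β' with h | h
      · rwa [inf_eq_left.2 h]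
      · rwa [inf_eq_right.2 h]
  transitive' {β} S hS R hR γ hγ := by
    obtain ⟨δ, g, hg, hδ⟩ := hS γ hγ
    obtain ⟨ε, k, hk, hε⟩ := hR hg γ hδ
    exact ⟨ε, k ≫ g, hk, hε⟩

/-- The category of `C`-valued sheaves on `α`. -/
abbrev Sh (α : Ordinal.{w}) (C : Type u) [Category.{v} C] := Sheaf (alexandrov α) C

/-- The constant sheaf functor `Δ`: the sheafification of the constant presheaf. -/
abbrev Delta (α : Ordinal.{w}) (C : Type u) [Category.{v} C] [HasWeakSheafify (alexandrov α) C] :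
    C ⥤ Sh α C :=
  constantSheaf (alexandrov α) C

/-- The global sections functor `Γ`: the value of a sheaf at the whole space `α`, which is the
limit of the sheaf because `α` is the largest stage. -/
abbrev Gamma (α : Ordinal.{w}) (C : Type u) [Category.{v} C] : Sh α C ⥤ C :=
  (sheafSections (alexandrov α) C).obj (op ⊤)

/-- The constant sheaf adjunction `Δ ⊣ Γ`, defined when the inclusion of sheaves into presheaves
has a left adjoint, the sheafification functor. -/
def deltaGammaAdj (α : Ordinal.{w}) (C : Type u) [Category.{v} C]
    [HasWeakSheafify (alexandrov α) C] : Delta α C ⊣ Gamma α C :=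
  constantSheafAdj (alexandrov α) C (IsTerminal.ofUniqueHom (fun β => homOfLE β.2)
    (fun _ _ => Subsingleton.elim _ _))

/-! ### Pointwise extensions of endofunctors, and the later functor -/

section Functors

variable (α : Ordinal.{w}) {C : Type u} [Category.{v} C] [HasWeakSheafify (alexandrov α) C]

/-- The pointwise extension of an endofunctor `F` to sheaves: include sheaves into presheaves,
apply `F` at each stage, sheafify. -/
def extP (F : C ⥤ C) : Sh α C ⥤ Sh α C :=
  sheafToPresheaf (alexandrov α) C ⋙ (Functor.whiskeringRight (Stage α)ᵒᵖ C C).obj F ⋙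
    presheafToSheaf (alexandrov α) C

variable {α} in
/-- The predecessor map `p β = sup {γ | γ < β}`: so `p (β + 1) = β`, and `p β = β` if `β` is zero
or a limit ordinal. -/
def pred (β : Stage α) : Stage α :=
  ⟨sSup (Set.Iio β.1), Set.mem_Iic.2 (csSup_le' fun _ hγ => (le_of_lt hγ).trans β.2)⟩

lemma pred_mono : Monotone (pred : Stage α → Stage α) := by
  intro β β' h
  have h' : β.1 ≤ β'.1 := h
  refine Subtype.mk_le_mk.2 (csSup_le' fun γ hγ => le_csSup ⟨β'.1, fun x hx => le_of_lt hx⟩ ?_)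
  exact lt_of_lt_of_le (Set.mem_Iio.1 hγ) h'

/-- The later endofunctor: precompose with the predecessor map, then sheafify. -/
def later : Sh α C ⥤ Sh α C :=
  sheafToPresheaf (alexandrov α) C ⋙
    (Functor.whiskeringLeft (Stage α)ᵒᵖ (Stage α)ᵒᵖ C).obj (pred_mono α).functor.op ⋙
    presheafToSheaf (alexandrov α) C

end Functors

/-! ### Sheafification only depends on the successor stages -/

section Successors

variable {α : Ordinal.{w}} {C : Type u} [Category.{v} C]

/-- The successor stages. -/
def isSuccStage (α : Ordinal.{w}) : ObjectProperty (Stage α) :=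
  fun β => ∃ γ : Ordinal.{w}, β.1 = Order.succ γ

instance : (isSuccStage α).ι.IsCoverDense (alexandrov α) where
  is_cover β γ hγ := by
    let δ : Stage α := ⟨Order.succ γ, (Order.succ_le_of_lt hγ).trans β.2⟩
    exact ⟨δ, homOfLE (Order.succ_le_of_lt hγ : δ.1 ≤ β.1),
      Presieve.in_coverByImage (isSuccStage α).ι (Y := ⟨δ, γ, rfl⟩) _, Order.lt_succ γ⟩

/-- A morphism of presheaves that is invertible at all successor stages is inverted by
sheafification. -/
lemma W_of_isIso_succ {P Q : (Stage α)ᵒᵖ ⥤ C} (f : P ⟶ Q)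
    (hf : ∀ β : Stage α, isSuccStage α β → IsIso (f.app (op β))) : (alexandrov α).W f := by
  intro G hG
  let ι := (isSuccStage α).ι
  have hP := Functor.whiskerLeft_obj_map_bijective_of_isCoverDense (K := alexandrov α) ι P G hG
  have hQ := Functor.whiskerLeft_obj_map_bijective_of_isCoverDense (K := alexandrov α) ι Q G hG
  have : IsIso (Functor.whiskerLeft ι.op f) := by
    have : ∀ X, IsIso ((Functor.whiskerLeft ι.op f).app X) := fun X => hf _ X.unop.2
    exact NatIso.isIso_of_isIso_app _
  constructor
  · intro a b hab
    apply hQ.1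
    have h := congrArg (Functor.whiskerLeft ι.op) hab
    simp only [Functor.whiskerLeft_comp] at h
    exact (cancel_epi (Functor.whiskerLeft ι.op f)).1 h
  · intro g
    obtain ⟨g', hg'⟩ := hQ.2 (inv (Functor.whiskerLeft ι.op f) ≫ Functor.whiskerLeft ι.op g)
    refine ⟨g', hP.1 ?_⟩
    change Functor.whiskerLeft ι.op (f ≫ g') = Functor.whiskerLeft ι.op g
    change Functor.whiskerLeft ι.op g' = _ at hg'
    rw [Functor.whiskerLeft_comp, hg', IsIso.hom_inv_id_assoc]

/-- The presheaf with value `Z` at the stages above `β` and a terminal object `t` elsewhere. -/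
def sky (β : Ordinal.{w}) {t : C} (ht : IsTerminal t) (Z : C) : (Stage α)ᵒᵖ ⥤ C where
  obj δ := open Classical in if β < δ.unop.1 then Z else t
  map {δ δ'} f := open Classical in
    if h : β < δ'.unop.1 then
      eqToHom ((if_pos (h.trans_le (leOfHom f.unop))).trans (if_pos h).symm)
    else ht.from _ ≫ eqToHom (if_neg h).symm
  map_id δ := by
    split_ifs with h
    · rfl
    · rw [← cancel_mono (eqToHom (if_neg h))]
      exact ht.hom_ext _ _
  map_comp {δ δ' δ''} f g := by
    by_cases h : β < δ''.unop.1
    · have h' := h.trans_le (leOfHom g.unop)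
      simp [h, h']
    · rw [dif_neg h, dif_neg h, ← Category.assoc]
      congr 1
      exact ht.hom_ext _ _

variable (β : Ordinal.{w}) {t : C} (ht : IsTerminal t)

lemma sky_obj (Z : C) {δ : (Stage α)ᵒᵖ} (h : β < δ.unop.1) : (sky β ht Z).obj δ = Z := if_pos h

lemma sky_map (Z : C) {δ δ' : (Stage α)ᵒᵖ} (f : δ ⟶ δ') (h : β < δ'.unop.1) :
    (sky β ht Z).map f =
      eqToHom ((sky_obj β ht Z (h.trans_le (leOfHom f.unop))).trans (sky_obj β ht Z h).symm) :=
  dif_pos h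

lemma sky_hom_ext (Z : C) {E : C} {δ : (Stage α)ᵒᵖ} (h : ¬ β < δ.unop.1)
    (a b : E ⟶ (sky β ht Z).obj δ) : a = b := by
  have e : (sky β ht Z).obj δ = t := if_neg h
  rw [← cancel_mono (eqToHom e)]
  exact ht.hom_ext _ _

lemma sky_isIso_map (Z : C) {δ δ' : (Stage α)ᵒᵖ} (f : δ ⟶ δ') (h : β < δ'.unop.1) :
    IsIso ((sky β ht Z).map f) := by
  rw [sky_map β ht Z f h]
  infer_instance

lemma sky_isSheaf (Z : C) : Presheaf.IsSheaf (alexandrov α) (sky β ht Z) := by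
  intro E δ S hS x hx
  by_cases h : β < δ.1
  · obtain ⟨ε, f, hf, hε⟩ := hS β h
    have := sky_isIso_map (α := α) β ht Z f.op hε
    refine ⟨x f hf ≫ inv ((sky β ht Z).map f.op), ?_, ?_⟩
    · intro ε' f' hf'
      by_cases h' : β < ε'.1
      · change (x f hf ≫ inv ((sky β ht Z).map f.op)) ≫ (sky β ht Z).map f'.op = x f' hf'
        let m : Stage α := ε ⊓ ε'
        have hm : β < m.1 := lt_inf_iff.2 ⟨hε, h'⟩
        let g : m ⟶ ε := homOfLE inf_le_left
        let g' : m ⟶ ε' := homOfLE inf_le_right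
        have key := hx g g' hf hf' (Subsingleton.elim _ _)
        change x f hf ≫ (sky β ht Z).map g.op = x f' hf' ≫ (sky β ht Z).map g'.op at key
        have := sky_isIso_map (α := α) β ht Z g'.op hm
        have e : (sky β ht Z).map f'.op ≫ (sky β ht Z).map g'.op =
            (sky β ht Z).map f.op ≫ (sky β ht Z).map g.op := by
          rw [← Functor.map_comp, ← Functor.map_comp]
          exact congrArg _ (Subsingleton.elim _ _)
        rw [← cancel_mono ((sky β ht Z).map g'.op), ← key, Category.assoc, Category.assoc, e,
          IsIso.inv_hom_id_assoc]
      · exact sky_hom_ext β ht Z h' _ _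
    · intro y hy
      have := hy f hf
      change y ≫ (sky β ht Z).map f.op = _ at this
      rw [← this, Category.assoc, IsIso.hom_inv_id, Category.comp_id]
  · refine ⟨ht.from _ ≫ eqToHom (if_neg h).symm, ?_, ?_⟩
    · intro ε f hf
      exact sky_hom_ext β ht Z (fun h' => h (h'.trans_le (leOfHom f))) _ _
    · intro y _
      exact sky_hom_ext β ht Z h _ _

/-- Morphisms into `sky` from values at the successor stage of `β`. -/
def toSky {P : (Stage α)ᵒᵖ ⥤ C} (hβ : Order.succ β ∈ Set.Iic α) {Z : C}
    (z : P.obj (op ⟨Order.succ β, hβ⟩) ⟶ Z) : P ⟶ sky β ht Z where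
  app δ := open Classical in
    if h : β < δ.unop.1 then
      P.map (homOfLE (Order.succ_le_of_lt h : (⟨Order.succ β, hβ⟩ : Stage α) ≤ δ.unop)).op ≫ z ≫
        eqToHom (sky_obj β ht Z h).symm
    else ht.from _ ≫ eqToHom (if_neg h).symm
  naturality δ δ' f := by
    by_cases h : β < δ'.unop.1
    · have h' := h.trans_le (leOfHom f.unop)
      rw [dif_pos h, dif_pos h', sky_map β ht Z f h, ← Category.assoc, ← Functor.map_comp]
      simp only [Category.assoc, eqToHom_trans]
      rfl
    · exact sky_hom_ext β ht Z h _ _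

lemma toSky_app {P : (Stage α)ᵒᵖ ⥤ C} (hβ : Order.succ β ∈ Set.Iic α) {Z : C}
    (z : P.obj (op ⟨Order.succ β, hβ⟩) ⟶ Z) :
    (toSky β ht hβ z).app (op ⟨Order.succ β, hβ⟩) = 
      z ≫ eqToHom (sky_obj β ht Z (Order.lt_succ β)).symm := by
  have : (toSky β ht hβ z).app (op ⟨Order.succ β, hβ⟩) = P.map (𝟙 _) ≫ z ≫ _ :=
    dif_pos (Order.lt_succ β)
  rw [this, P.map_id, Category.id_comp]

lemma comp_toSky {P Q : (Stage α)ᵒᵖ ⥤ C} (f : P ⟶ Q) (hβ : Order.succ β ∈ Set.Iic α) {Z : C}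
    (z : Q.obj (op ⟨Order.succ β, hβ⟩) ⟶ Z) :
    f ≫ toSky β ht hβ z = toSky β ht hβ (f.app _ ≫ z) := by
  ext δ
  by_cases h : β < δ.unop.1
  · have e₁ : (toSky β ht hβ z).app δ = Q.map _ ≫ z ≫ _ := dif_pos h
    have e₂ : (toSky β ht hβ (f.app _ ≫ z)).app δ = P.map _ ≫ (f.app _ ≫ z) ≫ _ := dif_pos h
    rw [NatTrans.comp_app, e₁, e₂]
    simp
  · exact sky_hom_ext β ht Z h _ _

/-- Conversely, a morphism of presheaves inverted by sheafification is invertible at all successor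
stages. -/
lemma isIso_succ_of_W [HasWeakSheafify (alexandrov α) C] {P Q : (Stage α)ᵒᵖ ⥤ C} (f : P ⟶ Q)
    (hf : (alexandrov α).W f) (β : Stage α) (hβ : isSuccStage α β) : IsIso (f.app (op β)) := by
  obtain ⟨β, hβα⟩ := β
  obtain ⟨γ, rfl⟩ : ∃ γ, β = Order.succ γ := hβ
  let bot : Stage α := ⟨0, Set.mem_Iic.2 (zero_le (a := α))⟩
  have ht : IsTerminal (((presheafToSheaf (alexandrov α) C).obj P).obj.obj (op bot)) :=
    Sheaf.isTerminalOfBotCover _ _ (fun δ hδ => absurd hδ (not_lt_bot))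
  obtain ⟨ψ, hψ⟩ := (hf _ (sky_isSheaf γ ht (P.obj (op ⟨Order.succ γ, hβα⟩)))).2
    (toSky γ ht hβα (𝟙 _))
  have e : (sky γ ht (P.obj (op ⟨Order.succ γ, hβα⟩))).obj (op ⟨Order.succ γ, hβα⟩) =
    P.obj (op ⟨Order.succ γ, hβα⟩) := sky_obj γ ht _ (Order.lt_succ γ)
  let s := ψ.app (op ⟨Order.succ γ, hβα⟩) ≫ eqToHom e
  have hs : f.app _ ≫ s = 𝟙 _ := by
    have := congrArg (fun k => NatTrans.app k (op ⟨Order.succ γ, hβα⟩) ≫ eqToHom e) hψ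
    dsimp only at this
    rw [NatTrans.comp_app, toSky_app, Category.assoc, Category.id_comp, eqToHom_trans,
      eqToHom_refl] at this
    exact this
  refine ⟨s, hs, ?_⟩
  have h := (hf _ (sky_isSheaf γ ht (Q.obj (op ⟨Order.succ γ, hβα⟩)))).1
    (a₁ := toSky γ ht hβα (s ≫ f.app _)) (a₂ := toSky γ ht hβα (𝟙 _)) (by
      change f ≫ _ = f ≫ _
      rw [comp_toSky, comp_toSky, reassoc_of% hs, Category.comp_id])
  have := congrArg (fun k => NatTrans.app k (op ⟨Order.succ γ, hβα⟩)) h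
  rw [toSky_app, toSky_app] at this
  exact (cancel_mono _).1 this

lemma W_iff_isIso_succ [HasWeakSheafify (alexandrov α) C] {P Q : (Stage α)ᵒᵖ ⥤ C} (f : P ⟶ Q) :
    (alexandrov α).W f ↔ ∀ β : Stage α, isSuccStage α β → IsIso (f.app (op β)) :=
  ⟨isIso_succ_of_W f, W_of_isIso_succ f⟩

/-- Applying an endofunctor at each stage preserves the morphisms inverted by sheafification. -/
lemma W_whiskerRight [HasWeakSheafify (alexandrov α) C] {P Q : (Stage α)ᵒᵖ ⥤ C} (f : P ⟶ Q)
    (hf : (alexandrov α).W f) (F : C ⥤ C) : (alexandrov α).W (Functor.whiskerRight f F) := by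
  rw [W_iff_isIso_succ] at hf ⊢
  intro β hβ
  have := hf β hβ
  exact inferInstanceAs (IsIso (F.map (f.app (op β))))

end Successors

/-! ### The pointwise extension of a monad -/

section Monads

/-- A monad on `C` acts on presheaves, stage by stage. -/
def presheafMonad (I : Type*) [Category* I] {C : Type u} [Category.{v} C] (T : Monad C) :
    Monad (I ⥤ C) where
  toFunctor := (Functor.whiskeringRight I C C).obj T.toFunctor
  η := { app := fun P => { app := fun i => T.η.app (P.obj i)
                           naturality := fun _ _ f => T.η.naturality (P.map f) }
         naturality := fun _ _ f => by ext i; exact T.η.naturality (f.app i) }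
  μ := { app := fun P => { app := fun i => T.μ.app (P.obj i)
                           naturality := fun _ _ f => T.μ.naturality (P.map f) }
         naturality := fun _ _ f => by ext i; exact T.μ.naturality (f.app i) }
  assoc P := by ext i; exact T.assoc (P.obj i)
  left_unit P := by ext i; exact T.left_unit (P.obj i)
  right_unit P := by ext i; exact T.right_unit (P.obj i)

lemma isIso_map_map {D S : Type*} [Category* D] [Category* S] {L : D ⥤ S} {R : S ⥤ D}
    (adj : L ⊣ R) (M : Monad D) (hM : ∀ P, IsIso (L.map (M.map (adj.unit.app P))))
    {P Q : D} (f : P ⟶ Q) (hf : IsIso (L.map f)) : IsIso (L.map (M.map f)) := by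
  have h : L.map (M.map f) ≫ L.map (M.map (adj.unit.app Q)) =
      L.map (M.map (adj.unit.app P)) ≫ L.map (M.map (R.map (L.map f))) := by
    rw [← L.map_comp, ← L.map_comp, ← M.map_comp, ← M.map_comp]
    exact congrArg _ (congrArg _ (adj.unit.naturality f))
  have := hM P
  have := hM Q
  exact IsIso.of_isIso_fac_right h

variable {D S : Type*} [Category* D] [Category* S] {L : D ⥤ S} {R : S ⥤ D} (adj : L ⊣ R)
  [R.Full] [R.Faithful] (M : Monad D)

lemma inv_counit_app_obj (Z : D) : inv (adj.counit.app (L.obj Z)) = L.map (adj.unit.app Z) := by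
  rw [IsIso.inv_eq_of_inv_hom_id]
  exact adj.left_triangle_components Z

lemma map_inv_counit_app (X : S) : R.map (inv (adj.counit.app X)) = adj.unit.app (R.obj X) := by
  rw [Functor.map_inv]
  rw [IsIso.inv_eq_of_inv_hom_id]
  exact adj.right_triangle_components X

/-- The monad `X ↦ L (M (R X))` on a reflective subcategory. Its unit is `X ≅ L R X ⟶ L M R X` and
its multiplication is `L M R L M R X ≅ L M M R X ⟶ L M R X`, where the isomorphisms are induced by
the counit and the unit of the reflection. -/
def reflectMonad (hM : ∀ P, IsIso (L.map (M.map (adj.unit.app P)))) : Monad S where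
  toFunctor := R ⋙ M.toFunctor ⋙ L
  η :=
    { app := fun X => inv (adj.counit.app X) ≫ L.map (M.η.app (R.obj X))
      naturality := fun X Y f => by
        have h₁ := adj.counit.naturality f
        have h₂ := M.η.naturality (R.map f)
        dsimp at h₁ h₂ ⊢
        rw [Category.assoc, ← L.map_comp, ← h₂, L.map_comp, ← Category.assoc, ← Category.assoc]
        congr 1
        rw [IsIso.eq_inv_comp, ← Category.assoc, IsIso.comp_inv_eq, h₁] }
  μ :=
    { app := fun X =>
        inv (L.map (M.map (adj.unit.app (M.obj (R.obj X))))) ≫ L.map (M.μ.app (R.obj X))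
      naturality := fun X Y f => by
        have h₁ := adj.unit.naturality (M.map (R.map f))
        have h₂ := M.μ.naturality (R.map f)
        dsimp at h₁ h₂ ⊢
        rw [← cancel_epi (L.map (M.map (adj.unit.app (M.obj (R.obj X)))))]
        simp only [Category.assoc, IsIso.hom_inv_id_assoc]
        rw [← L.map_comp, ← h₂, ← L.map_comp_assoc, ← M.map_comp, ← h₁, M.map_comp,
          L.map_comp_assoc, IsIso.hom_inv_id_assoc, L.map_comp] }
  assoc X := by
    let Z := M.obj (R.obj X)
    let W := M.obj (R.obj (L.obj Z))
    let A := L.map (M.map (adj.unit.app Z))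
    let B := L.map (M.map (adj.unit.app W))
    -- the unit followed by the multiplication
    have k : M.map (adj.unit.app Z) ≫ adj.unit.app W ≫ R.map (inv A ≫ L.map (M.μ.app (R.obj X))) =
        M.μ.app (R.obj X) ≫ adj.unit.app Z := by
      have h₁ := adj.unit.naturality (M.map (adj.unit.app Z))
      have h₂ := adj.unit.naturality (M.μ.app (R.obj X))
      dsimp at h₁ h₂
      rw [← Category.assoc, h₁, Category.assoc, ← R.map_comp, IsIso.hom_inv_id_assoc, ← h₂]
    have hn := M.μ.naturality (adj.unit.app Z)
    have hA : IsIso (L.map (M.map (M.map (adj.unit.app Z)))) :=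
      isIso_map_map adj M hM _ (hM Z)
    change L.map (M.map (R.map (inv A ≫ L.map (M.μ.app (R.obj X))))) ≫ inv A ≫ L.map _ =
      (inv B ≫ L.map (M.μ.app _)) ≫ inv A ≫ L.map _
    rw [← cancel_epi B, Category.assoc, IsIso.hom_inv_id_assoc,
      ← cancel_epi (L.map (M.map (M.map (adj.unit.app Z))))]
    simp only [B, ← L.map_comp_assoc, ← M.map_comp, k]
    dsimp at hn
    rw [hn, M.map_comp, L.map_comp_assoc, L.map_comp_assoc, IsIso.hom_inv_id_assoc,
      ← L.map_comp, ← L.map_comp, M.assoc]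
  left_unit X := by
    have h := M.η.naturality (adj.unit.app (M.obj (R.obj X)))
    dsimp at h ⊢
    rw [inv_counit_app_obj, Category.assoc, ← L.map_comp_assoc, h, L.map_comp_assoc,
      IsIso.hom_inv_id_assoc, ← L.map_comp, M.left_unit]
    exact L.map_id _
  right_unit X := by
    have h := adj.unit.naturality (M.η.app (R.obj X))
    dsimp at h ⊢
    rw [R.map_comp, map_inv_counit_app, ← h, M.map_comp, L.map_comp_assoc,
      IsIso.hom_inv_id_assoc, ← L.map_comp, M.right_unit]
    exact L.map_id _

/-- The pointwise extension of a monad `T` to sheaves: its underlying functor is `extP α T`, and its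
unit and multiplication are, up to the canonical isomorphisms `X ≅ extP α (𝟭 C) X` and
`extP α T (extP α T X) ≅ extP α (T ⋙ T) X`, the pointwise extensions of those of `T`. -/
def extMonad (α : Ordinal.{w}) {C : Type u} [Category.{v} C] [HasWeakSheafify (alexandrov α) C]
    (T : Monad C) : Monad (Sh α C) :=
  reflectMonad (sheafificationAdjunction (alexandrov α) C) (presheafMonad (Stage α)ᵒᵖ T)
    fun P => ((alexandrov α).W_iff _).1
      (W_whiskerRight _ ((alexandrov α).W_toSheafify P) T.toFunctor)

lemma extMonad_toFunctor (α : Ordinal.{w}) {C : Type u} [Category.{v} C]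
    [HasWeakSheafify (alexandrov α) C] (T : Monad C) :
    (extMonad α T).toFunctor = extP α T.toFunctor := rfl

end Monads

/-! ### Kleisli liftings -/

/-- An endofunctor `H` of the Kleisli category of `T` is a Kleisli lifting of `G` if it agrees with
`G` along the canonical functor `K` into the Kleisli category. -/
def IsKleisliLifting {D : Type*} [Category* D] (T : Monad D) (G : D ⥤ D)
    (H : Kleisli T ⥤ Kleisli T) : Prop :=
  Kleisli.Adjunction.toKleisli T ⋙ H = G ⋙ Kleisli.Adjunction.toKleisli T

/-- The image under `K` of an isomorphism `X ≅ G X`, as an isomorphism `K X ≅ H (K X)` for a Kleisli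
lifting `H` of `G`; note that `H (K X) = K (G X)`. -/
def IsKleisliLifting.mapInvariant {D : Type*} [Category* D] {T : Monad D} {G : D ⥤ D}
    {H : Kleisli T ⥤ Kleisli T} (hH : IsKleisliLifting T G H) {X : D} (c : X ≅ G.obj X) :
    (Kleisli.Adjunction.toKleisli T).obj X ≅ H.obj ((Kleisli.Adjunction.toKleisli T).obj X) :=
  (Kleisli.Adjunction.toKleisli T).mapIso c ≪≫ eqToIso (Functor.congr_obj hH X).symm

/-! ### Invariants -/

/-- An invariant `e : X ≅ H X` of an endofunctor is the unique one if it is a final coalgebra, its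
inverse is an initial algebra, and there is exactly one isomorphism of coalgebras to it from any
other invariant. -/
structure IsUniqueInvariant {D : Type*} [Category* D] (H : D ⥤ D) {X : D} (e : X ≅ H.obj X) :
    Prop where
  unique : ∀ (Y : D) (k : Y ≅ H.obj Y), ∃! i : Y ≅ X, k.hom ≫ H.map i.hom = i.hom ≫ e.hom
  final : Nonempty (IsTerminal (⟨X, e.hom⟩ : Endofunctor.Coalgebra H))
  initial : Nonempty (IsInitial (⟨X, e.inv⟩ : Endofunctor.Algebra H))

/-! ### Final sequences -/

section FinalSequences

variable {C : Type u} [Category.{v} C]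

/-- The cone over `(Φ β)_{β < γ}` given by the restrictions `Φ γ ⟶ Φ β`. -/
def restrictionCone (Φ : Ordinal.{w}ᵒᵖ ⥤ C) (γ : Ordinal.{w}) :
    Cone ((Subtype.mono_coe (· ∈ Set.Iio γ)).functor.op ⋙ Φ) where
  pt := Φ.obj (op γ)
  π :=
    { app := fun β => Φ.map (homOfLE (le_of_lt β.unop.2)).op
      naturality := fun _ _ f => by
        dsimp
        rw [Category.id_comp, ← Φ.map_comp]
        rfl }

/-- A final sequence of an endofunctor `F`: objects `Φ β` for all ordinals `β` and morphisms
`Φ β' ⟶ Φ β` for `β ≤ β'` such that `Φ (β + 1) = F (Φ β)`, the morphism `Φ (β' + 1) ⟶ Φ (β + 1)` is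
`F (Φ β' ⟶ Φ β)`, and `Φ γ` is the limit of `(Φ β)_{β < γ}` if `γ` is zero or a limit ordinal. -/
structure FinalSequence (F : C ⥤ C) where
  seq : Ordinal.{w}ᵒᵖ ⥤ C
  obj_succ : ∀ β : Ordinal.{w}, seq.obj (op (Order.succ β)) = F.obj (seq.obj (op β))
  map_succ : ∀ {β β' : Ordinal.{w}} (h : β ≤ β'),
    seq.map (homOfLE (Order.succ_le_succ h)).op =
      eqToHom (obj_succ β') ≫ F.map (seq.map (homOfLE h).op) ≫ eqToHom (obj_succ β).symm
  isLimit : ∀ γ : Ordinal.{w}, Order.IsSuccPrelimit γ → Nonempty (IsLimit (restrictionCone seq γ))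

namespace FinalSequence

variable {F : C ⥤ C} (Φ : FinalSequence.{w} F)

/-- The final sequence is stable at `α` if `Φ (α + 1) ⟶ Φ α` is an isomorphism. -/
def StableAt (α : Ordinal.{w}) : Prop :=
  IsIso (Φ.seq.map (homOfLE (Order.le_succ α)).op)

/-- The restriction of the final sequence to the stages `β ≤ α` is a sheaf. -/
def sheaf (α : Ordinal.{w}) : Sh α C where
  obj := (Subtype.mono_coe (· ∈ Set.Iic α)).functor.op ⋙ Φ.seq
  property := by
    intro E β S hS x hx
    -- restricting `x` at `f` to a smaller stage
    have hr : ∀ {δ δ' : Stage α} (f : δ ⟶ β) (f' : δ' ⟶ β) (hf : S f) (hf' : S f') (g : δ' ⟶ δ),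
        x f hf ≫ Φ.seq.map (homOfLE (leOfHom g : δ'.1 ≤ δ.1)).op = x f' hf' := by
      intro δ δ' f f' hf hf' g
      have h := hx g (𝟙 δ') hf hf' (Subsingleton.elim _ _)
      have h' : x f hf ≫ Φ.seq.map (homOfLE (leOfHom g : δ'.1 ≤ δ.1)).op =
        x f' hf' ≫ Φ.seq.map (𝟙 _) := h
      rw [Φ.seq.map_id] at h'
      exact h'.trans (Category.comp_id _)
    by_cases hβ : S (𝟙 β)
    · refine ⟨x (𝟙 β) hβ, fun δ f hf => hr _ _ hβ hf f, fun y hy => ?_⟩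
      have h : y ≫ Φ.seq.map (𝟙 _) = x (𝟙 β) hβ := hy _ hβ
      rw [Φ.seq.map_id] at h
      exact (Category.comp_id _).symm.trans h
    · have hlt : ∀ {δ : Stage α} (f : δ ⟶ β), S f → δ.1 < β.1 := by
        intro δ f hf
        refine lt_of_le_of_ne (leOfHom f) fun h => hβ ?_
        obtain rfl : δ = β := Subtype.ext h
        exact (Subsingleton.elim f (𝟙 δ)) ▸ hf
      have hmem : ∀ γ : Ordinal.{w}, ∀ h : γ < β.1,
          S (homOfLE h.le : (⟨γ, h.le.trans β.2⟩ : Stage α) ⟶ β) := by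
        intro γ h
        obtain ⟨δ, f, hf, hδ⟩ := hS γ h
        have h' : (⟨γ, h.le.trans β.2⟩ : Stage α) ≤ δ := hδ.le
        have h'' := S.downward_closed hf (homOfLE h')
        rwa [Subsingleton.elim (homOfLE h' ≫ f) (homOfLE h.le)] at h''
      have hp : Order.IsSuccPrelimit β.1 := by
        intro γ hγ
        obtain ⟨δ, f, hf, hδ⟩ := hS γ hγ.lt
        exact hγ.2 hδ (hlt f hf)
      obtain ⟨hl⟩ := Φ.isLimit β.1 hp
      let s : Cone ((Subtype.mono_coe (· ∈ Set.Iio β.1)).functor.op ⋙ Φ.seq) :=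
        { pt := E
          π :=
            { app := fun γ => x _ (hmem γ.unop.1 γ.unop.2)
              naturality := fun γ γ' f => by
                have h : (⟨γ'.unop.1, (le_of_lt (Set.mem_Iio.1 γ'.unop.2)).trans β.2⟩ : Stage α) ≤
                  ⟨γ.unop.1, (le_of_lt (Set.mem_Iio.1 γ.unop.2)).trans β.2⟩ := leOfHom f.unop
                exact (Category.id_comp _).trans
                  (hr _ _ (hmem γ.unop.1 γ.unop.2) (hmem γ'.unop.1 γ'.unop.2) (homOfLE h)).symm } }
      refine ⟨hl.lift s, fun δ f hf => hl.fac s (op ⟨δ.1, hlt f hf⟩), fun y hy => ?_⟩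
      exact hl.uniq s y fun γ => hy _ (hmem γ.unop.1 γ.unop.2)

section Identity

variable {α : Ordinal.{w}} [HasWeakSheafify (alexandrov α) C]

/-- An isomorphism from the final sequence to its guarded pointwise extension is the identity if at
each successor stage `β + 1` it is the canonical identification
`Φ (β + 1) = F (Φ β) = F (Φ (p (β + 1))) ≅ F ((later Φ) (β + 1)) ≅ (extP F (later Φ)) (β + 1)`,
where the isomorphisms are components of the unit of sheafification. -/
def IsIdentity (c : Φ.sheaf α ≅ (later α ⋙ extP α F).obj (Φ.sheaf α)) : Prop :=
  ∀ (β : Ordinal.{w}) (hβ : Order.succ β ∈ Set.Iic α),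
    c.hom.hom.app (op ⟨Order.succ β, hβ⟩) =
      eqToHom (Φ.obj_succ β) ≫
        F.map (Φ.seq.map (homOfLE (csSup_le' fun _ hγ => Order.lt_succ_iff.1 hγ :
          (pred (⟨Order.succ β, hβ⟩ : Stage α)).1 ≤ β)).op) ≫
        F.map ((toSheafify (alexandrov α)
          ((pred_mono α).functor.op ⋙ (Φ.sheaf α).obj)).app (op ⟨Order.succ β, hβ⟩)) ≫
        (toSheafify (alexandrov α) (((later α).obj (Φ.sheaf α)).obj ⋙ F)).app
          (op ⟨Order.succ β, hβ⟩)

end Identity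

end FinalSequence

end FinalSequences

end KleisliTrace

end

/-!
Sheaves on `α` are determined by their values at the successor stages, and there
`(extP F (later X)) (β + 1)` is `F (X β)`. An equation `f = a ≫ extP E (later f) ≫ b` between
sheaf morphisms therefore says that `f` at stage `β + 1` is a prescribed function of `f` at stage
`β`: it is solved, uniquely, by transfinite recursion, the values at limit stages being glued from
the earlier ones. Equations in the Kleisli category of `extP T` along a lifting of
`extP F ∘ later` reduce to equations of this form for `E = T ∘ F`. Finally, an endofunctor all of
whose equations `f = a ≫ H f ≫ b` have exactly one solution has at most one invariant, which is a
final coalgebra and whose inverse is an initial algebra. The final sequence yields an invariant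
because it is itself a sheafification of `β ↦ F (Φ (pred β))`.
-/

namespace KleisliTrace

section Sheafification

lemma existsUnique_iso_of_W {I A : Type*} [Category* I] [Category* A]
    {J : GrothendieckTopology I} {P : Iᵒᵖ ⥤ A} {X Y : Sheaf J A} {f : P ⟶ X.obj} {g : P ⟶ Y.obj}
    (hf : J.W f) (hg : J.W g) : ∃! c : X ≅ Y, f ≫ c.hom.hom = g := by
  obtain ⟨h, hfh : f ≫ h = g⟩ := (hf _ Y.property).2 g
  have hW : J.W h := J.W.of_precomp f h hf (hfh ▸ hg)
  let h' : X ⟶ Y := ⟨h⟩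
  have : IsIso h' := (J.W_sheafToPresheaf_map_iff_isIso h').1 hW
  refine ⟨asIso h', hfh, fun c hc => Iso.ext (Sheaf.hom_ext ?_)⟩
  exact (hf _ Y.property).1 (hc.trans hfh.symm)

end Sheafification

section SuccessorStages

variable {α : Ordinal.{w}} {C : Type u} [Category.{v} C]

lemma coe_pred_succ {β : Ordinal.{w}} (hβ : Order.succ β ∈ Set.Iic α) :
    (pred (⟨Order.succ β, hβ⟩ : Stage α)).1 = β := by
  change sSup (Set.Iio (Order.succ β)) = β
  rw [Order.Iio_succ, csSup_Iic]

lemma pred_lt_of_isSuccStage {ε : Stage α} (hε : isSuccStage α ε) : pred ε < ε := by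
  obtain ⟨ε, hεα⟩ := ε
  obtain ⟨β, rfl⟩ : ∃ β, ε = Order.succ β := hε
  exact (coe_pred_succ hεα).trans_lt (Order.lt_succ β)

lemma le_succ_pred (β : Stage α) : β.1 ≤ Order.succ (pred β).1 :=
  le_of_forall_lt fun _ hγ =>
    Order.lt_succ_iff.2 (le_csSup ⟨β.1, fun _ hx => le_of_lt hx⟩ hγ)

/-- The family of all successor stages below `β`; it generates a covering sieve, along which
sections of sheaves are glued. -/
def succPresieve (β : Stage α) : Presieve β := fun ε _ => isSuccStage α ε

lemma generate_succPresieve_mem (β : Stage α) :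
    Sieve.generate (succPresieve β) ∈ alexandrov α β := fun γ hγ =>
  ⟨⟨Order.succ γ, (Order.succ_le_of_lt hγ).trans β.2⟩, homOfLE (Order.succ_le_of_lt hγ),
    Sieve.le_generate _ _ _ ⟨γ, rfl⟩, Order.lt_succ γ⟩

variable {Y Z : (Stage α)ᵒᵖ ⥤ C} (hZ : Presheaf.IsSheaf (alexandrov α) Z)
include hZ

lemma isSheafFor_succPresieve (E : C) (β : Stage α) :
    Presieve.IsSheafFor (Z ⋙ coyoneda.obj (op E)) (succPresieve β) :=
  (Presieve.isSheafFor_iff_generate _).2 (hZ E _ (generate_succPresieve_mem β))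

lemma hom_ext_succ {E : C} {β : Stage α} {a b : E ⟶ Z.obj (op β)}
    (h : ∀ (ε : Stage α) (f : ε ⟶ β), isSuccStage α ε → a ≫ Z.map f.op = b ≫ Z.map f.op) :
    a = b :=
  (isSheafFor_succPresieve hZ E β).isSeparatedFor.ext h

lemma exists_glue_succ {E : C} {β : Stage α}
    (s : ∀ ε : Stage α, (ε ⟶ β) → isSuccStage α ε → (E ⟶ Z.obj (op ε)))
    (hs : ∀ {δ ε : Stage α} (f : ε ⟶ β) (g : δ ⟶ ε) (hδ : isSuccStage α δ)
      (hε : isSuccStage α ε), s ε f hε ≫ Z.map g.op = s δ (g ≫ f) hδ) :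
    ∃ a : E ⟶ Z.obj (op β), ∀ (ε : Stage α) (f : ε ⟶ β) (hε : isSuccStage α ε),
      a ≫ Z.map f.op = s ε f hε := by
  let x : Presieve.FamilyOfElements (Z ⋙ coyoneda.obj (op E)) (succPresieve β) := s
  have compatible {δ ε η : Stage α} (g : η ⟶ ε) (g' : η ⟶ δ) (f : ε ⟶ β) (f' : δ ⟶ β)
      (hε : isSuccStage α ε) (hδ : isSuccStage α δ) :
      s ε f hε ≫ Z.map g.op = s δ f' hδ ≫ Z.map g'.op := by
    refine hom_ext_succ hZ fun ζ k hζ => ?_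
    rw [Category.assoc, Category.assoc, ← Z.map_comp, ← Z.map_comp, ← op_comp, ← op_comp,
      hs f (k ≫ g) hζ hε, hs f' (k ≫ g') hζ hδ,
      Subsingleton.elim ((k ≫ g) ≫ f) ((k ≫ g') ≫ f')]
  obtain ⟨a, ha, -⟩ := isSheafFor_succPresieve hZ E β x
    fun _ _ _ g g' f f' hε hδ _ => compatible g g' f f' hε hδ
  exact ⟨a, ha⟩

lemma natTrans_ext_succ {f g : Y ⟶ Z}
    (h : ∀ ε : Stage α, isSuccStage α ε → f.app (op ε) = g.app (op ε)) : f = g := by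
  ext ⟨β⟩
  refine hom_ext_succ hZ fun ε k hε => ?_
  rw [← f.naturality, ← g.naturality, h ε hε]

end SuccessorStages

section GuardedRecursion

variable {α : Ordinal.{w}} {C : Type u} [Category.{v} C]

/-- The data of a recursive definition of a morphism `Y ⟶ Z`: how the component at a successor stage
is obtained from the component at its predecessor, compatibly with restriction. -/
structure GuardedStep (Y Z : (Stage α)ᵒᵖ ⥤ C) where
  app {ε : Stage α} (hε : isSuccStage α ε)
    (a : Y.obj (op (pred ε)) ⟶ Z.obj (op (pred ε))) : Y.obj (op ε) ⟶ Z.obj (op ε)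
  commSq {δ ε : Stage α} (hδ : isSuccStage α δ) (hε : isSuccStage α ε) (g : δ ⟶ ε)
    {a : Y.obj (op (pred ε)) ⟶ Z.obj (op (pred ε))}
    {b : Y.obj (op (pred δ)) ⟶ Z.obj (op (pred δ))}
    (h : CommSq a (Y.map ((pred_mono α).functor.map g).op)
      (Z.map ((pred_mono α).functor.map g).op) b) :
    CommSq (app hε a) (Y.map g.op) (Z.map g.op) (app hδ b)

namespace GuardedStep

variable {Y Z : (Stage α)ᵒᵖ ⥤ C} (s : GuardedStep Y Z)

/-- A morphism of presheaves solves the recursion if its components at successor stages are those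
prescribed by the step. -/
def IsSolution (f : Y ⟶ Z) : Prop :=
  ∀ ⦃ε : Stage α⦄ (hε : isSuccStage α ε), f.app (op ε) = s.app hε (f.app (op (pred ε)))

/-- The graph of the recursion: `s.IsValue β a` says that `a` is the component at `β` of the
solution. It is a relation and not a function because a value at `β` can be glued only once the
values at earlier stages are known to be compatible. -/
inductive IsValue : ∀ β : Stage α, (Y.obj (op β) ⟶ Z.obj (op β)) → Prop
  | glue (β : Stage α) (a : Y.obj (op β) ⟶ Z.obj (op β))
      (v : ∀ ε : Stage α, (ε ⟶ β) → isSuccStage α ε →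
        (Y.obj (op (pred ε)) ⟶ Z.obj (op (pred ε))))
      (hv : ∀ ε f hε, IsValue (pred ε) (v ε f hε))
      (ha : ∀ ε (f : ε ⟶ β) hε, a ≫ Z.map f.op = Y.map f.op ≫ s.app hε (v ε f hε)) : IsValue β a

variable {s}

lemma IsSolution.isValue {f : Y ⟶ Z} (hf : s.IsSolution f) (β : Stage α) :
    s.IsValue β (f.app (op β)) := by
  induction β using WellFoundedLT.induction with
  | ind β ih =>
    refine .glue β _ (fun ε _ _ => f.app (op (pred ε)))
      (fun ε k hε => ih _ ((pred_lt_of_isSuccStage hε).trans_le (leOfHom k))) fun ε k hε => ?_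
    rw [← f.naturality, hf hε]

variable (hZ : Presheaf.IsSheaf (alexandrov α) Z)
include hZ

lemma IsValue.unique {β : Stage α} {a b : Y.obj (op β) ⟶ Z.obj (op β)}
    (ha : s.IsValue β a) (hb : s.IsValue β b) : a = b := by
  induction β using WellFoundedLT.induction with
  | ind β ih =>
    obtain ⟨_, _, v, hv, ha⟩ := ha
    obtain ⟨_, _, v', hv', hb⟩ := hb
    refine hom_ext_succ hZ fun ε f hε => ?_
    rw [ha ε f hε, hb ε f hε,
      ih _ ((pred_lt_of_isSuccStage hε).trans_le (leOfHom f)) (hv ε f hε) (hv' ε f hε)]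

lemma IsValue.commSq {β δ : Stage α} (g : δ ⟶ β) {a : Y.obj (op β) ⟶ Z.obj (op β)}
    {b : Y.obj (op δ) ⟶ Z.obj (op δ)} (ha : s.IsValue β a) (hb : s.IsValue δ b) :
    CommSq a (Y.map g.op) (Z.map g.op) b := by
  obtain ⟨_, _, v, hv, ha⟩ := ha
  obtain ⟨_, _, v', hv', hb⟩ := hb
  refine ⟨hom_ext_succ hZ fun ε f hε => ?_⟩
  rw [Category.assoc, Category.assoc, hb ε f hε, ← Z.map_comp, ← Y.map_comp_assoc, ← op_comp,
    ha ε (f ≫ g) hε, (hv ε (f ≫ g) hε).unique hZ (hv' ε f hε)]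

lemma exists_isValue (s : GuardedStep Y Z) (β : Stage α) : ∃ a, s.IsValue β a := by
  induction β using WellFoundedLT.induction with
  | ind β ih =>
    choose v hv using fun (ε : Stage α) (f : ε ⟶ β) (hε : isSuccStage α ε) =>
      ih (pred ε) ((pred_lt_of_isSuccStage hε).trans_le (leOfHom f))
    obtain ⟨a, ha⟩ := exists_glue_succ hZ (fun ε f hε => Y.map f.op ≫ s.app hε (v ε f hε))
      fun {δ ε} f g hδ hε => by
        have hstep := (s.commSq hδ hε g ((hv ε f hε).commSq hZ _ (hv δ (g ≫ f) hδ))).w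
        rw [Category.assoc, hstep, ← Y.map_comp_assoc, op_comp]
    exact ⟨a, .glue β a v hv ha⟩

theorem existsUnique_isSolution (s : GuardedStep Y Z) : ∃! f : Y ⟶ Z, s.IsSolution f := by
  choose a ha using s.exists_isValue hZ
  let f : Y ⟶ Z :=
    { app := fun β => a β.unop
      naturality := fun β δ g => ((ha β.unop).commSq hZ g.unop (ha δ.unop)).w.symm }
  refine ⟨f, fun ε hε => ?_, fun g hg => ?_⟩
  · obtain ⟨_, _, v, hv, hs⟩ := ha ε
    have hε' : a ε = s.app hε (v ε (𝟙 ε) hε) := by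
      simpa only [op_id, Z.map_id, Y.map_id, Category.comp_id, Category.id_comp] using hs ε (𝟙 ε) hε
    exact hε'.trans (congrArg _ ((hv ε (𝟙 ε) hε).unique hZ (ha (pred ε))))
  · ext ⟨β⟩
    exact (hg.isValue β).unique hZ (ha β)

end GuardedStep

end GuardedRecursion

section Hylomorphisms

variable {D : Type*} [Category* D]

/-- Every coalgebra-to-algebra equation for `H` has exactly one solution; equivalently, in the
usual terminology, all `H`-coalgebras are recursive and all `H`-algebras corecursive. -/
def HasUniqueHylomorphisms (H : D ⥤ D) : Prop :=
  ∀ ⦃Y Z : D⦄ (a : Y ⟶ H.obj Y) (b : H.obj Z ⟶ Z), ∃! f : Y ⟶ Z, f = a ≫ H.map f ≫ b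

namespace HasUniqueHylomorphisms

lemma of_iso {G G' : D ⥤ D} (i : G ≅ G') (hG : HasUniqueHylomorphisms G) :
    HasUniqueHylomorphisms G' := by
  intro Y Z a b
  simpa only [Category.assoc, i.hom.naturality_assoc, i.inv_hom_id_app_assoc] using
    hG (a ≫ i.inv.app Y) (i.hom.app Z ≫ b)

variable {H : D ⥤ D} (hH : HasUniqueHylomorphisms H) {X : D} (e : X ≅ H.obj X)
include hH

lemma nonempty_isTerminal :
    Nonempty (IsTerminal (⟨X, e.hom⟩ : Endofunctor.Coalgebra H)) := by
  have isHom_iff (V : Endofunctor.Coalgebra H) (f : V.V ⟶ X) :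
      f = V.str ≫ H.map f ≫ e.inv ↔ V.str ≫ H.map f = f ≫ e.hom := by
    rw [← Category.assoc, Iso.eq_comp_inv, eq_comm]
  choose f hf hf_unique using fun V : Endofunctor.Coalgebra H => hH V.str e.inv
  refine ⟨IsTerminal.ofUniqueHom (fun V => ⟨f V, (isHom_iff V _).1 (hf V)⟩) fun V m => ?_⟩
  exact Endofunctor.Coalgebra.Hom.ext (hf_unique V _ ((isHom_iff V _).2 m.h))

lemma nonempty_isInitial :
    Nonempty (IsInitial (⟨X, e.inv⟩ : Endofunctor.Algebra H)) := by
  have isHom_iff (A : Endofunctor.Algebra H) (f : X ⟶ A.a) :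
      f = e.hom ≫ H.map f ≫ A.str ↔ H.map f ≫ A.str = e.inv ≫ f := by
    rw [Iso.eq_inv_comp, eq_comm]
  choose f hf hf_unique using fun A : Endofunctor.Algebra H => hH e.hom A.str
  refine ⟨IsInitial.ofUniqueHom (fun A => ⟨f A, (isHom_iff A _).1 (hf A)⟩) fun A m => ?_⟩
  exact Endofunctor.Algebra.Hom.ext (hf_unique A _ ((isHom_iff A _).2 m.h))

theorem isUniqueInvariant : IsUniqueInvariant H e where
  unique Y k := by
    obtain ⟨hX⟩ := hH.nonempty_isTerminal e
    obtain ⟨hY⟩ := hH.nonempty_isTerminal k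
    let i := hY.uniqueUpToIso hX
    refine ⟨(Endofunctor.Coalgebra.forget H).mapIso i, i.hom.h, fun j hj => Iso.ext ?_⟩
    exact congrArg Endofunctor.Coalgebra.Hom.f (hX.hom_ext ⟨j.hom, hj⟩ i.hom)
  final := hH.nonempty_isTerminal e
  initial := hH.nonempty_isInitial e

end HasUniqueHylomorphisms

end Hylomorphisms

section KleisliLiftings

namespace HasUniqueHylomorphisms

variable {D E : Type*} [Category* D] [Category* E]

/-- Transposing along `K ⊣ R` turns an equation for `H` into one for `G ⋙ K ⋙ R`. -/
lemma existsUnique_of_adjunction {K : D ⥤ E} {R : E ⥤ D} (adj : K ⊣ R) {G : D ⥤ D} {H : E ⥤ E}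
    (i : K ⋙ H ≅ G ⋙ K) (hG : HasUniqueHylomorphisms (G ⋙ K ⋙ R)) {Y : D} {X : E}
    (a : K.obj Y ⟶ H.obj (K.obj Y)) (b : H.obj X ⟶ X) :
    ∃! f : K.obj Y ⟶ X, f = a ≫ H.map f ≫ b := by
  let A : Y ⟶ R.obj (K.obj (G.obj Y)) := adj.homEquiv _ _ (a ≫ i.hom.app Y)
  let B : R.obj (K.obj (G.obj (R.obj X))) ⟶ R.obj X :=
    R.map (i.inv.app (R.obj X) ≫ H.map (adj.counit.app X) ≫ b)
  have map_transpose (g : Y ⟶ R.obj X) : H.map ((adj.homEquiv Y X).symm g) =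
      i.hom.app Y ≫ K.map (G.map g) ≫ i.inv.app (R.obj X) ≫ H.map (adj.counit.app X) := by
    have h := i.hom.naturality_assoc g (i.inv.app (R.obj X) ≫ H.map (adj.counit.app X))
    rw [i.hom_inv_id_app_assoc] at h
    rw [adj.homEquiv_counit, H.map_comp]
    exact h
  have transpose (g : Y ⟶ R.obj X) :
      (adj.homEquiv Y X).symm g = a ≫ H.map ((adj.homEquiv Y X).symm g) ≫ b ↔
        g = A ≫ R.map (K.map (G.map g)) ≫ B := by
    rw [Equiv.symm_apply_eq, map_transpose, ← R.map_comp, ← adj.homEquiv_naturality_right]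
    simp only [Category.assoc]
  exact (adj.homEquiv Y X).symm.existsUnique_congr (fun {g} => (transpose g).symm) |>.1 (hG A B)

end HasUniqueHylomorphisms

theorem IsKleisliLifting.hasUniqueHylomorphisms {D : Type*} [Category* D] {M : Monad D}
    {G : D ⥤ D} {H : Kleisli M ⥤ Kleisli M} (hH : IsKleisliLifting M G H)
    (hG : HasUniqueHylomorphisms (G ⋙ M.toFunctor)) : HasUniqueHylomorphisms H :=
  fun Y _ a b =>
    (hG.of_iso (Functor.isoWhiskerLeft G
      (Kleisli.Adjunction.toKleisliCompFromKleisliIsoSelf M).symm)).existsUnique_of_adjunction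
        (Kleisli.Adjunction.adj M) (eqToIso hH) (Y := Y.of) a b

end KleisliLiftings

noncomputable section GuardedExtensions

variable {α : Ordinal.{w}} {C : Type u} [Category.{v} C]

/-- The endofunctor `G` of sheaves sends `X` to the sheafification of the presheaf
`β ↦ E (X (pred β))`, exhibited by a natural morphism that sheafification inverts. -/
structure GuardedExtension (E : C ⥤ C) (G : Sh α C ⥤ Sh α C) where
  unit : sheafToPresheaf (alexandrov α) C ⋙
      (Functor.whiskeringLeft _ _ C).obj (pred_mono α).functor.op ⋙
        (Functor.whiskeringRight _ C C).obj E ⟶ G ⋙ sheafToPresheaf (alexandrov α) C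
  W_unit (X : Sh α C) : (alexandrov α).W (unit.app X)

namespace GuardedExtension

variable [HasWeakSheafify (alexandrov α) C]

variable (α C) in
/-- The later functor guards the identity. -/
def later : GuardedExtension (𝟭 C) (later α) where
  unit :=
    { app X := toSheafify (alexandrov α) ((pred_mono α).functor.op ⋙ X.obj)
      naturality _ _ f := toSheafify_naturality (alexandrov α)
        (Functor.whiskerLeft (pred_mono α).functor.op f.hom) }
  W_unit _ := (alexandrov α).W_toSheafify _

/-- Guarded extensions remain guarded after a pointwise extension. -/
def compExtP {E : C ⥤ C} {G : Sh α C ⥤ Sh α C} (θ : GuardedExtension E G) (F : C ⥤ C) :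
    GuardedExtension (E ⋙ F) (G ⋙ extP α F) where
  unit :=
    { app X := Functor.whiskerRight (θ.unit.app X) F ≫ toSheafify _ ((G.obj X).obj ⋙ F)
      naturality _ _ f :=
        (((CommSq.mk (θ.unit.naturality f)).map ((Functor.whiskeringRight _ _ _).obj F)).vert_comp
          (CommSq.mk (toSheafify_naturality (alexandrov α)
            (Functor.whiskerRight (G.map f).hom F)))).w }
  W_unit X := (alexandrov α).W.comp_mem _ _ (W_whiskerRight _ (θ.W_unit X) F)
    ((alexandrov α).W_toSheafify _)

variable {E : C ⥤ C} {G : Sh α C ⥤ Sh α C} (θ : GuardedExtension E G)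

/-- The canonical identification of `G X` at a successor stage. -/
def succIso (X : Sh α C) {ε : Stage α} (hε : isSuccStage α ε) :
    E.obj (X.obj.obj (op (pred ε))) ≅ (G.obj X).obj.obj (op ε) :=
  @asIso _ _ _ _ ((θ.unit.app X).app (op ε)) (isIso_succ_of_W _ (θ.W_unit X) ε hε)

lemma succIso_hom_commSq (X : Sh α C) {δ ε : Stage α} (hδ : isSuccStage α δ)
    (hε : isSuccStage α ε) (g : δ ⟶ ε) :
    CommSq (θ.succIso X hε).hom (E.map (X.obj.map ((pred_mono α).functor.map g).op))
      ((G.obj X).obj.map g.op) (θ.succIso X hδ).hom :=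
  ⟨((θ.unit.app X).naturality g.op).symm⟩

lemma succIso_hom_comp_map {X Y : Sh α C} (f : X ⟶ Y) {ε : Stage α} (hε : isSuccStage α ε) :
    (θ.succIso X hε).hom ≫ (G.map f).hom.app (op ε) =
      E.map (f.hom.app (op (pred ε))) ≫ (θ.succIso Y hε).hom :=
  (congrArg (fun k => NatTrans.app k (op ε)) (θ.unit.naturality f)).symm

/-- The recursion solved by the solutions of `f = A ≫ G f ≫ B`. -/
def hyloStep {Y Z : Sh α C} (A : Y ⟶ G.obj Y) (B : G.obj Z ⟶ Z) :
    GuardedStep Y.obj Z.obj where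
  app {ε} hε a :=
    A.hom.app (op ε) ≫ ((θ.succIso Y hε).inv ≫ E.map a ≫ (θ.succIso Z hε).hom) ≫ B.hom.app (op ε)
  commSq hδ hε g _ _ h :=
    (CommSq.mk (A.hom.naturality g.op).symm).horiz_comp
      (((θ.succIso_hom_commSq Y hδ hε g).horiz_inv.horiz_comp
        ((h.map E).horiz_comp (θ.succIso_hom_commSq Z hδ hε g))).horiz_comp
          (CommSq.mk (B.hom.naturality g.op).symm))

lemma isSolution_hyloStep_iff {Y Z : Sh α C} (A : Y ⟶ G.obj Y) (B : G.obj Z ⟶ Z) (f : Y ⟶ Z) :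
    (θ.hyloStep A B).IsSolution f.hom ↔ f = A ≫ G.map f ≫ B := by
  have happ {ε : Stage α} (hε : isSuccStage α ε) :
      (θ.hyloStep A B).app hε (f.hom.app (op (pred ε))) =
        (A ≫ G.map f ≫ B).hom.app (op ε) := by
    have hG := (Iso.inv_comp_eq _).2 (θ.succIso_hom_comp_map f hε).symm
    exact congrArg (fun k => A.hom.app (op ε) ≫ k ≫ B.hom.app (op ε)) hG
  constructor
  · intro hf
    exact Sheaf.hom_ext (natTrans_ext_succ Z.property fun ε hε => (hf hε).trans (happ hε))
  · intro hf ε hε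
    rw [happ hε, ← hf]

include θ in
theorem hasUniqueHylomorphisms : HasUniqueHylomorphisms G := by
  intro Y Z A B
  obtain ⟨f, hf, hf_unique⟩ := (θ.hyloStep A B).existsUnique_isSolution Z.property
  refine ⟨⟨f⟩, (θ.isSolution_hyloStep_iff A B ⟨f⟩).1 hf, fun g hg => Sheaf.hom_ext ?_⟩
  exact hf_unique _ ((θ.isSolution_hyloStep_iff A B g).2 hg)

end GuardedExtension

end GuardedExtensions

namespace FinalSequence

variable {C : Type u} [Category.{v} C] {F : C ⥤ C} (Φ : FinalSequence.{w} F)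

lemma map_map_comp_eqToHom_map {β β' δ : Ordinal.{w}} (h : β ≤ β') (hδ : δ ≤ Order.succ β) :
    F.map (Φ.seq.map (homOfLE h).op) ≫ eqToHom (Φ.obj_succ β).symm ≫ Φ.seq.map (homOfLE hδ).op =
      eqToHom (Φ.obj_succ β').symm ≫
        Φ.seq.map (homOfLE (hδ.trans (Order.succ_le_succ h))).op := by
  have hcomp : (homOfLE (hδ.trans (Order.succ_le_succ h))).op =
    (homOfLE (Order.succ_le_succ h)).op ≫ (homOfLE hδ).op := rfl
  rw [hcomp, Φ.seq.map_comp, Φ.map_succ h]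
  simp only [Category.assoc, eqToHom_trans_assoc, eqToHom_refl, Category.id_comp]

/-- The canonical morphisms `F (Φ (pred β)) = Φ (pred β + 1) ⟶ Φ β`; they exhibit `Φ` as a
sheafification of the presheaf `β ↦ F (Φ (pred β))`. -/
noncomputable def ofPred (α : Ordinal.{w}) :
    (pred_mono α).functor.op ⋙ (Φ.sheaf α).obj ⋙ F ⟶ (Φ.sheaf α).obj where
  app β := eqToHom (Φ.obj_succ (pred β.unop).1).symm ≫
    Φ.seq.map (homOfLE (le_succ_pred β.unop)).op
  naturality β δ g := by
    have hcomp := Φ.seq.map_comp (homOfLE (le_succ_pred β.unop)).op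
      (homOfLE (leOfHom g.unop : δ.unop.1 ≤ β.unop.1)).op
    exact (Φ.map_map_comp_eqToHom_map (pred_mono α (leOfHom g.unop)) (le_succ_pred δ.unop)).trans
      ((congrArg _ hcomp).trans (Category.assoc _ _ _).symm)

variable {α : Ordinal.{w}}

/-- The identification `Φ (β + 1) = F (Φ β) = F (Φ (pred (β + 1)))` at a successor stage. -/
noncomputable def succIso {β : Ordinal.{w}} (hβ : Order.succ β ∈ Set.Iic α) :
    Φ.seq.obj (op (Order.succ β)) ≅
      F.obj (Φ.seq.obj (op (pred (⟨Order.succ β, hβ⟩ : Stage α)).1)) :=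
  eqToIso (Φ.obj_succ β) ≪≫ F.mapIso (Φ.seq.mapIso (eqToIso (coe_pred_succ hβ)).op)

lemma ofPred_app_succ {β : Ordinal.{w}} (hβ : Order.succ β ∈ Set.Iic α) :
    (Φ.ofPred α).app (op ⟨Order.succ β, hβ⟩) = (Φ.succIso hβ).inv := by
  have h : β ≤ (pred (⟨Order.succ β, hβ⟩ : Stage α)).1 := (coe_pred_succ hβ).ge
  change eqToHom (Φ.obj_succ _).symm ≫ Φ.seq.map (homOfLE (Order.succ_le_succ h)).op =
    F.map (Φ.seq.map (homOfLE h).op) ≫ eqToHom (Φ.obj_succ β).symm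
  rw [Φ.map_succ, eqToHom_trans_assoc, eqToHom_refl, Category.id_comp]

lemma W_ofPred : (alexandrov α).W (Φ.ofPred α) := by
  refine W_of_isIso_succ _ ?_
  rintro ⟨_, hβ⟩ ⟨β, rfl⟩
  exact (Φ.ofPred_app_succ hβ).symm ▸ (Φ.succIso hβ).isIso_inv

variable [HasWeakSheafify (alexandrov α) C]

lemma isIdentity_iff (c : Φ.sheaf α ≅ (later α ⋙ extP α F).obj (Φ.sheaf α)) :
    Φ.IsIdentity c ↔
      Φ.ofPred α ≫ c.hom.hom =
        ((GuardedExtension.later α C).compExtP F).unit.app (Φ.sheaf α) := by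
  have eq_comp_iff {β : Ordinal.{w}} (hβ : Order.succ β ∈ Set.Iic α) {V : C}
      (t : F.obj (Φ.seq.obj (op (pred (⟨Order.succ β, hβ⟩ : Stage α)).1)) ⟶ V)
      (k : Φ.seq.obj (op (Order.succ β)) ⟶ V) :
      k = (Φ.succIso hβ).hom ≫ t ↔ (Φ.ofPred α).app (op ⟨Order.succ β, hβ⟩) ≫ k = t := by
    rw [Φ.ofPred_app_succ hβ]
    exact (Iso.inv_comp_eq _).symm
  constructor
  · intro hc
    refine natTrans_ext_succ ((later α ⋙ extP α F).obj (Φ.sheaf α)).property ?_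
    rintro ⟨_, hβ⟩ ⟨β, rfl⟩
    exact (eq_comp_iff hβ _ _).1 ((hc β hβ).trans (Category.assoc _ _ _).symm)
  · intro hc β hβ
    have hcβ := congrArg (fun k => NatTrans.app k (op ⟨Order.succ β, hβ⟩)) hc
    exact ((eq_comp_iff hβ _ _).2 hcβ).trans (Category.assoc _ _ _)

theorem existsUnique_isIdentity :
    ∃! c : Φ.sheaf α ≅ (later α ⋙ extP α F).obj (Φ.sheaf α), Φ.IsIdentity c := by
  simpa only [isIdentity_iff] using existsUnique_iso_of_W Φ.W_ofPred
    (((GuardedExtension.later α C).compExtP F).W_unit (Φ.sheaf α))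

end FinalSequence

end KleisliTrace

theorem mainTheorem2_general {C : Type u} [Category.{v} C] (T : Monad C) (F : C ⥤ C)
    (α : Ordinal.{w}) [HasWeakSheafify (KleisliTrace.alexandrov α) C]
    (Φ : KleisliTrace.FinalSequence.{w} F)
    (H : Kleisli (KleisliTrace.extMonad α T) ⥤ Kleisli (KleisliTrace.extMonad α T))
    (hH : KleisliTrace.IsKleisliLifting (KleisliTrace.extMonad α T)
      (KleisliTrace.later α ⋙ KleisliTrace.extP α F) H) :
    (∃! c : Φ.sheaf α ≅ (KleisliTrace.later α ⋙ KleisliTrace.extP α F).obj (Φ.sheaf α),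
      Φ.IsIdentity c) ∧
    ∀ (X : Kleisli (KleisliTrace.extMonad α T)) (e : X ≅ H.obj X),
      KleisliTrace.IsUniqueInvariant H e := by
  have hylo := (((KleisliTrace.GuardedExtension.later α C).compExtP F).compExtP
    T.toFunctor).hasUniqueHylomorphisms
  exact ⟨Φ.existsUnique_isIdentity, fun _ e => (hH.hasUniqueHylomorphisms hylo).isUniqueInvariant e⟩

theorem mainTheorem2 {C : Type u} [Category.{v} C] (T : Monad C) (F : C ⥤ C)
    (α : Ordinal.{w}) [HasWeakSheafify (KleisliTrace.alexandrov α) C]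
    (Φ : KleisliTrace.FinalSequence.{w} F) (hΦ : Φ.StableAt α)
    (H : Kleisli (KleisliTrace.extMonad α T) ⥤ Kleisli (KleisliTrace.extMonad α T))
    (hH : KleisliTrace.IsKleisliLifting (KleisliTrace.extMonad α T)
      (KleisliTrace.later α ⋙ KleisliTrace.extP α F) H) :
    (∃! c : Φ.sheaf α ≅ (KleisliTrace.later α ⋙ KleisliTrace.extP α F).obj (Φ.sheaf α),
      Φ.IsIdentity c) ∧
    ∀ c : Φ.sheaf α ≅ (KleisliTrace.later α ⋙ KleisliTrace.extP α F).obj (Φ.sheaf α),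
      Φ.IsIdentity c → KleisliTrace.IsUniqueInvariant H (hH.mapInvariant c) := by
  obtain ⟨identity, invariant⟩ := mainTheorem2_general T F α Φ H hH
  exact ⟨identity, fun c _ => invariant _ (hH.mapInvariant c)⟩
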